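/- Let $d\ge 1$ and let $X=\{1,\dots,d\}^{\mathbb N}$ be the full one-sided shift space with the shift map $\sigma$ and the metric $d_\theta$, for a fixed $0<\theta<1$, where $d_\theta(x,y)=\theta^{m}$ if $x\ne y$ first differ in their $m$-th symbol ($m\ge1$), and $d_\theta(x,x)=0$. Let $f:X\to\mathbb R$ be Lipschitz for $d_\theta$. For $g:X\to\mathbb R$ write $g^n(x)=\sum_{i=0}^{n-1}g(\sigma^i x)$ and $\mathrm{Fix}_n=\{x\in X:\sigma^n x=x\}$, let $P$ denote topological pressure, and put $\beta(f)=\sup_\nu\int f\,d\nu$, the supremum over all $\sigma$-invariant Borel probabilities $\nu$ on $X$. For $c\in\mathbb R$ and an integer $N\ge1$ let $\pi_{c,N}$ be the probability on $X$ with $$\int g\,d\pi_{c,N}=\frac{\sum_{n=1}^{N}\sum_{x\in \mathrm{Fix}_n}e^{c f^n(x)-nP(cf)}\,\frac{g^n(x)}{n}}{\sum_{n=1}^{N}\sum_{x\in \mathrm{Fix}_n}e^{c f^n(x)-nP(cf)}}$$ for all continuous $g:X\to\mathbb R$. Let $\mathrm{Per}$ be the set of periodic points of $\sigma$. For $x\in\mathrm{Per}$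 with minimal period $n_x$ let $$I(x)=n_x\Big(\beta(f)-\frac{f^{n_x}(x)}{n_x}\Big),$$ and for every $x\in X$ let $\widetilde I(x)=\lim_{\epsilon\to0^+}\inf\{I(y):y\in\mathrm{Per},\ d_\theta(y,x)\le\epsilon\}\in[0,\infty]$. Then, for every cylinder $k\subset X$ (the set of all points that begin with a given finite, possibly empty, word), $\pi_{c,N}(k)>0$ for all sufficiently large $c$ and $N$, and $$\lim_{c,N\to\infty,\ N/c\to0}\ \frac1c\log \pi_{c,N}(k)=-\inf_{x\in k\cap \mathrm{Per}}I(x)=-\inf_{x\in k}\widetilde I(x).$$ -/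

import Mathlib

open MeasureTheory Filter Topology

noncomputable section

namespace PeriodicLDP

/-- The one-sided full shift space on `d` symbols, with the product topology and its Borel
sigma-algebra (coordinates are numbered from `0`). -/
abbrev ShiftSpace (d : ℕ) : Type := ℕ → Fin d

/-- The left shift. -/
def shift (d : ℕ) (x : ShiftSpace d) : ShiftSpace d := fun n => x (n + 1)

open Classical in
/-- The metric `d_θ`: if `x` and `y` differ for the first time in their `m`-th symbol, counted
from `1`, then their distance is `θ ^ m`. (`PiNat.firstDiff` counts from `0`.) -/
def thetaDist {d : ℕ} (θ : ℝ) (x y : ShiftSpace d) : ℝ :=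
  if x = y then 0 else θ ^ (PiNat.firstDiff x y + 1)

/-- Lipschitz functions for the metric `d_θ`. -/
def IsThetaLipschitz {d : ℕ} (θ : ℝ) (f : ShiftSpace d → ℝ) : Prop :=
  ∃ C : ℝ, ∀ x y : ShiftSpace d, |f x - f y| ≤ C * thetaDist θ x y

/-- The cylinder `[w₁ … w_m]` of all points whose first `m` symbols form the word `w`. -/
def cylinder {d m : ℕ} (w : Fin m → Fin d) : Set (ShiftSpace d) :=
  {x | ∀ i : Fin m, x i = w i}

/-- `β(f)`, the supremum of `∫ f dν` over the shift-invariant Borel probabilities `ν`. -/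
def beta {d : ℕ} (f : ShiftSpace d → ℝ) : ℝ :=
  sSup {r : ℝ | ∃ ν : Measure (ShiftSpace d), IsProbabilityMeasure ν ∧
    MeasurePreserving (shift d) ν ν ∧ r = ∫ x, f x ∂ν}

/-- The topological pressure of a potential on the full shift: the exponential growth rate of
`∑_{|w| = n} sup_{x ∈ [w]} exp (gⁿ(x))`, where `gⁿ` is the `n`-th Birkhoff sum. -/
def pressure {d : ℕ} (g : ShiftSpace d → ℝ) : ℝ :=
  limsup (fun n : ℕ => Real.log (∑ w : Fin n → Fin d,
    sSup ((fun x => Real.exp (birkhoffSum (shift d) g n x)) '' cylinder w)) / n) atTop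

/-- `Fix_n`, the solutions of `σⁿ x = x`. -/
def fixSet (d n : ℕ) : Set (ShiftSpace d) := {x | (shift d)^[n] x = x}

/-- The weight `exp (c fⁿ(x) - n P(c f))`. -/
def weight {d : ℕ} (f : ShiftSpace d → ℝ) (c : ℝ) (n : ℕ) (x : ShiftSpace d) : ℝ :=
  Real.exp (c * birkhoffSum (shift d) f n x - n * pressure (fun y => c * f y))

/-- The normalising constant `∑_{n=1}^N ∑_{x ∈ Fix_n} exp (c fⁿ(x) - n P(c f))`. -/
def partitionSum {d : ℕ} (f : ShiftSpace d → ℝ) (c : ℝ) (N : ℕ) : ℝ :=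
  ∑ n ∈ Finset.Icc 1 N, ∑ᶠ x ∈ fixSet d n, weight f c n x

/-- The uniform distribution on the orbit segment `x, σ x, …, σ^(n-1) x`. -/
def orbitMeasure {d : ℕ} (n : ℕ) (x : ShiftSpace d) : Measure (ShiftSpace d) :=
  (n : ENNReal)⁻¹ • ∑ i ∈ Finset.range n, Measure.dirac ((shift d)^[i] x)

/-- The measure `π_{c,N}`; its integrals are computed in `integral_piMeasure`. -/
def piMeasure {d : ℕ} (f : ShiftSpace d → ℝ) (c : ℝ) (N : ℕ) : Measure (ShiftSpace d) :=
  ∑ n ∈ Finset.Icc 1 N, ∑ᶠ x ∈ fixSet d n,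
    ENNReal.ofReal (weight f c n x / partitionSum f c N) • orbitMeasure n x

/-- The periodic points of the shift. -/
def Per (d : ℕ) : Set (ShiftSpace d) := Function.periodicPts (shift d)

/-- The function `I` on periodic points: `I(x) = n_x (β(f) - f^{n_x}(x) / n_x)`, where `n_x` is
the minimal period of `x`. (Only its values at periodic points are ever used.) -/
def rate {d : ℕ} (f : ShiftSpace d → ℝ) (x : ShiftSpace d) : ℝ :=
  (Function.minimalPeriod (shift d) x : ℝ) * (beta f -
    birkhoffSum (shift d) f (Function.minimalPeriod (shift d) x) x /
      (Function.minimalPeriod (shift d) x : ℝ))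

/-- `inf {I(y) : y periodic, d(y, x) ≤ ε}`, equal to `+∞` if there is no such `y`. -/
def localInf {d : ℕ} (θ : ℝ) (f : ShiftSpace d → ℝ) (x : ShiftSpace d) (ε : ℝ) : EReal :=
  ⨅ y ∈ {y | y ∈ Per d ∧ thetaDist θ y x ≤ ε}, (rate f y : EReal)

/-- The extension `Ĩ(x) = lim_{ε → 0} inf {I(y) : y periodic, d(y, x) ≤ ε}`. The infimum grows
as `ε` decreases, so the limit is the supremum over `ε > 0`; see `tendsto_localInf`. -/
def rateExt {d : ℕ} (θ : ℝ) (f : ShiftSpace d → ℝ) (x : ShiftSpace d) : EReal :=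
  ⨆ ε ∈ Set.Ioi (0 : ℝ), localInf θ f x ε

/-- `rateExt` is indeed the limit. -/
theorem tendsto_localInf {d : ℕ} (θ : ℝ) (f : ShiftSpace d → ℝ) (x : ShiftSpace d) :
    Tendsto (localInf θ f x) (𝓝[>] 0) (𝓝 (rateExt θ f x)) := by
  have h : Antitone (localInf θ f x) := fun a b hab =>
    biInf_mono fun y hy => ⟨hy.1, hy.2.trans hab⟩
  have := h.tendsto_nhdsGT (0 : ℝ)
  rwa [sSup_image] at this

theorem shift_iterate_apply {d : ℕ} (n : ℕ) (x : ShiftSpace d) (m : ℕ) :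
    (shift d)^[n] x m = x (m + n) := by
  induction n generalizing x with
  | zero => rfl
  | succ n ih =>
    rw [Function.iterate_succ_apply, ih]
    exact congrArg x (by omega)

/-- `Fix_n` is finite, so the sums over it are genuine finite sums. -/
theorem fixSet_finite (d n : ℕ) (hn : 1 ≤ n) : (fixSet d n).Finite := by
  have hinj : Set.InjOn (fun (x : ShiftSpace d) (i : Fin n) => x i) (fixSet d n) := by
    intro x hx y hy hxy
    funext m
    induction m using Nat.strong_induction_on with
    | _ m ih =>
      by_cases hm : m < n
      · exact congrFun hxy ⟨m, hm⟩
      · have h1 := shift_iterate_apply n x (m - n)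
        have h2 := shift_iterate_apply n y (m - n)
        have hx' : (shift d)^[n] x = x := hx
        have hy' : (shift d)^[n] y = y := hy
        rw [hx', Nat.sub_add_cancel (by omega)] at h1
        rw [hy', Nat.sub_add_cancel (by omega)] at h2
        rw [← h1, ← h2]
        exact ih _ (by omega)
  exact Set.Finite.of_finite_image (Set.toFinite _) hinj

theorem partitionSum_nonneg {d : ℕ} (f : ShiftSpace d → ℝ) (c : ℝ) (N : ℕ) :
    0 ≤ partitionSum f c N :=
  Finset.sum_nonneg fun _ _ => finsum_mem_induction (fun r : ℝ => 0 ≤ r) le_rfl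
    (fun _ _ => add_nonneg) (fun _ _ => (Real.exp_pos _).le)

/-- The defining formula of `π_{c,N}`, for an arbitrary function `g`. -/
theorem integral_piMeasure {d : ℕ} (f g : ShiftSpace d → ℝ) (c : ℝ) (N : ℕ) :
    ∫ x, g x ∂(piMeasure f c N) =
      (∑ n ∈ Finset.Icc 1 N, ∑ᶠ x ∈ fixSet d n,
        weight f c n x * (birkhoffSum (shift d) g n x / n)) /
      (∑ n ∈ Finset.Icc 1 N, ∑ᶠ x ∈ fixSet d n, weight f c n x) := by
  have hdirac : ∀ a : ShiftSpace d, Integrable g (Measure.dirac a) := fun a =>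
    integrable_dirac (by simp)
  have horb : ∀ n, 1 ≤ n → ∀ x : ShiftSpace d, Integrable g (orbitMeasure n x) := by
    intro n hn x
    refine Integrable.smul_measure ?_ (by simp; omega)
    exact integrable_finsetSum_measure.2 fun i _ => hdirac _
  have hint : ∀ n ∈ Finset.Icc 1 N, ∀ x : ShiftSpace d, Integrable g
      (ENNReal.ofReal (weight f c n x / partitionSum f c N) • orbitMeasure n x) :=
    fun n hn x => (horb n (Finset.mem_Icc.1 hn).1 x).smul_measure ENNReal.ofReal_ne_top
  change _ = _ / partitionSum f c N
  rw [piMeasure, integral_finsetSum_measure, Finset.sum_div]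
  · refine Finset.sum_congr rfl fun n hn => ?_
    have hfin := fixSet_finite d n (Finset.mem_Icc.1 hn).1
    rw [finsum_mem_eq_finite_toFinset_sum _ hfin, finsum_mem_eq_finite_toFinset_sum _ hfin,
      integral_finsetSum_measure fun x _ => hint n hn x, Finset.sum_div]
    refine Finset.sum_congr rfl fun x _ => ?_
    rw [integral_smul_measure, orbitMeasure, integral_smul_measure,
      integral_finsetSum_measure fun i _ => hdirac _]
    simp only [integral_dirac, birkhoffSum]
    rw [ENNReal.toReal_ofReal (div_nonneg (show 0 ≤ weight f c n x from (Real.exp_pos _).le)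
      (partitionSum_nonneg f c N))]
    simp only [smul_eq_mul, ENNReal.toReal_inv, ENNReal.toReal_natCast]
    ring
  · intro n hn
    rw [finsum_mem_eq_finite_toFinset_sum _ (fixSet_finite d n (Finset.mem_Icc.1 hn).1)]
    exact integrable_finsetSum_measure.2 fun x _ => hint n hn x

end PeriodicLDP

end

namespace PeriodicLDP

/-! This is a Laplace-type argument. The mass of a cylinder is a quotient of two sums over periodic
points (`visitSum`). Since c β(f) ≤ P(cf) ≤ log d + c β(f) (`le_pressure`, `pressure_le`), the
weight of x in Fix_n is exp(-c (n β(f) - fⁿ(x))) up to a factor between exp(-n log d) and 1.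
Moreover n β(f) - fⁿ(x) is a positive integer multiple of I(x) ≥ 0, hence at least I(x). There are
at most N d^N terms, so when N/c → 0 only the infimum of I over the contributing orbits survives
after taking (1/c) log: `visitSum_le` bounds all terms at once, and `le_visitSum` keeps one nearly
optimal orbit.

The denominator disappears because I has infimum 0 over all periodic points (`exists_rate_lt`). This
is the substantial point: n β(f) - fⁿ(x) must be small without division by n, whereas approximating
β(f) by periodic averages controls only the quotient by n. If every such deficit were at least δ,
long periodic orbits could be cut repeatedly into orbits of bounded period (`exists_cut`), each cut
costing δ/2 and each piece losing δ. Periodic averages would then stay a fixed distance below β(f),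
which is impossible.

The formula with the extended rate holds because cylinders are open (`coe_sInf_rate_eq`). -/

variable {d : ℕ} {f : ShiftSpace d → ℝ} {C θ : ℝ}

/-! ### Variation on cylinders and distortion of Birkhoff sums -/

/-- `f` varies by at most `C * θ ^ n` on cylinders of length `n`. -/
noncomputable def HasVariation (f : ShiftSpace d → ℝ) (C θ : ℝ) : Prop :=
  ∀ (n : ℕ) (x y : ShiftSpace d), (∀ t < n, x t = y t) → |f x - f y| ≤ C * θ ^ n

theorem thetaDist_le_of_agree (h0 : 0 < θ) (h1 : θ < 1) {n : ℕ} {x y : ShiftSpace d}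
    (h : ∀ t < n, x t = y t) : thetaDist θ x y ≤ θ ^ n := by
  unfold thetaDist
  split_ifs with hxy
  · positivity
  · apply pow_le_pow_of_le_one h0.le h1.le
    by_contra! hlt
    exact PiNat.apply_firstDiff_ne hxy (h _ (by omega))

theorem agree_of_thetaDist_le (h0 : 0 < θ) (h1 : θ < 1) {n : ℕ} {x y : ShiftSpace d}
    (h : thetaDist θ x y ≤ θ ^ (n + 1)) : ∀ t < n, x t = y t := by
  intro t ht
  unfold thetaDist at h
  split_ifs at h with hxy
  · rw [hxy]
  · have := (pow_le_pow_iff_right_of_lt_one₀ h0 h1).1 h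
    exact PiNat.apply_eq_of_lt_firstDiff (by omega)

theorem IsThetaLipschitz.hasVariation (h0 : 0 < θ) (h1 : θ < 1) (hf : IsThetaLipschitz θ f) :
    ∃ C, 0 ≤ C ∧ HasVariation f C θ := by
  obtain ⟨C, hC⟩ := hf
  refine ⟨|C|, abs_nonneg C, fun n x y h => (hC x y).trans ?_⟩
  have hd : 0 ≤ thetaDist θ x y := by
    unfold thetaDist
    split_ifs <;> positivity
  exact (mul_le_mul_of_nonneg_right (le_abs_self C) hd).trans
    (mul_le_mul_of_nonneg_left (thetaDist_le_of_agree h0 h1 h) (abs_nonneg C))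

theorem HasVariation.continuous (h0 : 0 < θ) (h1 : θ < 1) (hf : HasVariation f C θ) :
    Continuous f := by
  rw [continuous_iff_continuousAt]
  intro x
  rw [ContinuousAt, Metric.tendsto_nhds]
  intro ε hε
  have ht : Tendsto (fun n : ℕ => C * θ ^ n) atTop (𝓝 0) := by
    simpa using (tendsto_pow_atTop_nhds_zero_of_lt_one h0.le h1).const_mul C
  obtain ⟨n, hn⟩ := (ht.eventually (gt_mem_nhds hε)).exists
  have hopen : ∀ᶠ y in 𝓝 x, ∀ t ∈ Set.Iio n, y t = x t := by
    rw [Filter.eventually_all_finite (Set.finite_Iio n)]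
    intro t _
    exact (continuous_apply t).continuousAt.preimage_mem_nhds
      ((isOpen_discrete {x t}).mem_nhds rfl)
  filter_upwards [hopen] with y hy
  rw [Real.dist_eq]
  exact (hf n y x hy).trans_lt hn

/-- After i shifts the points still agree on q + L - i symbols, so the differences are dominated by
a geometric series. The bound is uniform in q, and L extra symbols of agreement make it small. -/
theorem HasVariation.abs_birkhoffSum_sub_le (h0 : 0 < θ) (h1 : θ < 1) (hC : 0 ≤ C)
    (hf : HasVariation f C θ) (q L : ℕ) {x z : ShiftSpace d} (h : ∀ t < q + L, x t = z t) :
    |birkhoffSum (shift d) f q x - birkhoffSum (shift d) f q z| ≤ C / (1 - θ) * θ ^ L := by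
  have h2 : 0 < 1 - θ := by linarith
  -- The induction needs the partial geometric sum, here with one factor θ given away.
  suffices hs : |birkhoffSum (shift d) f q x - birkhoffSum (shift d) f q z| ≤
      C / (1 - θ) * θ ^ L * (1 - θ ^ q) by
    refine hs.trans (mul_le_of_le_one_right (by positivity) ?_)
    have := pow_pos h0 q
    linarith
  induction q generalizing x z with
  | zero => simp
  | succ q ih =>
    have ha := hf _ x z h
    have hb := ih (x := shift d x) (z := shift d z) fun t ht => h (t + 1) (by omega)
    rw [birkhoffSum_succ', birkhoffSum_succ', add_sub_add_comm]
    refine (abs_add_le _ _).trans ((add_le_add ha hb).trans ?_)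
    have hK : C = C / (1 - θ) * (1 - θ) := by field_simp
    have hp : C * θ ^ (q + 1 + L) = C / (1 - θ) * θ ^ L * (θ ^ (q + 1) - θ ^ (q + 2)) := by
      nth_rewrite 1 [hK]
      ring
    have hle : θ ^ (q + 1) - θ ^ (q + 2) ≤ θ ^ q - θ ^ (q + 1) := by
      have : 0 ≤ θ ^ q * (1 - θ) ^ 2 := by positivity
      nlinarith [pow_succ θ q, pow_succ θ (q + 1)]
    rw [hp, ← mul_add]
    exact mul_le_mul_of_nonneg_left (by linarith) (by positivity)

/-! ### Closing words to periodic points -/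

/-- The point with period `q` that agrees with `x` on the first `q` symbols. -/
def periodicExtension (q : ℕ) (x : ShiftSpace d) : ShiftSpace d := fun t => x (t % q)

theorem mem_fixSet_iff {n : ℕ} {x : ShiftSpace d} : x ∈ fixSet d n ↔ ∀ t, x (t + n) = x t := by
  simp only [fixSet, Set.mem_ofPred_eq, funext_iff, shift_iterate_apply]

theorem periodicExtension_mem_fixSet (q : ℕ) (x : ShiftSpace d) :
    periodicExtension q x ∈ fixSet d q := by
  simp [mem_fixSet_iff, periodicExtension]

/-- A near-return after q steps prolongs the agreement with the periodic closing from q to q + L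
symbols, which is what makes closing cheap. -/
theorem agree_periodicExtension {q L : ℕ} {x : ShiftSpace d} (h : ∀ t < L, x (t + q) = x t) :
    ∀ t < q + L, x t = periodicExtension q x t := by
  intro t
  induction t using Nat.strong_induction_on with
  | _ t ih =>
    intro ht
    by_cases hq : t < q
    · simp [periodicExtension, Nat.mod_eq_of_lt hq]
    · rcases Nat.eq_zero_or_pos q with rfl | hq0
      · simp [periodicExtension]
      · have h1 := h (t - q) (by omega)
        rw [Nat.sub_add_cancel (by omega)] at h1
        rw [h1, ih (t - q) (by omega) (by omega), periodicExtension, periodicExtension,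
          ← Nat.mod_eq_sub_mod (by omega)]

theorem shift_iterate_mem_fixSet {n : ℕ} {x : ShiftSpace d} (hx : x ∈ fixSet d n) (i : ℕ) :
    (shift d)^[i] x ∈ fixSet d n := by
  rw [mem_fixSet_iff] at hx ⊢
  intro t
  rw [shift_iterate_apply, shift_iterate_apply, ← hx (t + i)]
  congr 1
  omega

theorem birkhoffSum_shift_iterate {n : ℕ} {x : ShiftSpace d} (hx : x ∈ fixSet d n)
    (g : ShiftSpace d → ℝ) (i : ℕ) :
    birkhoffSum (shift d) g n ((shift d)^[i] x) = birkhoffSum (shift d) g n x := by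
  induction i with
  | zero => rfl
  | succ i ih =>
    rw [Function.iterate_succ_apply', ← ih, ← sub_eq_zero, birkhoffSum_apply_sub_birkhoffSum,
      show (shift d)^[n] ((shift d)^[i] x) = (shift d)^[i] x from shift_iterate_mem_fixSet hx i,
      sub_self]

theorem birkhoffSum_mul_of_mem_fixSet {p : ℕ} {x : ShiftSpace d} (hx : x ∈ fixSet d p)
    (g : ShiftSpace d → ℝ) (j : ℕ) :
    birkhoffSum (shift d) g (p * j) x = j * birkhoffSum (shift d) g p x := by
  have hp : Function.IsPeriodicPt (shift d) p x := hx
  induction j with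
  | zero => simp
  | succ j ih =>
    rw [Nat.mul_succ, birkhoffSum_add, ih, (hp.mul_const j).eq]
    push_cast
    ring

/-! ### Orbit measures and invariant integrals -/

theorem measurable_shift : Measurable (shift d) :=
  measurable_pi_lambda _ fun n => measurable_pi_apply (n + 1)

theorem isProbabilityMeasure_orbitMeasure {n : ℕ} (hn : 1 ≤ n) (x : ShiftSpace d) :
    IsProbabilityMeasure (orbitMeasure n x) := by
  constructor
  have h0 : (n : ENNReal) ≠ 0 := by simp; omega
  simp [orbitMeasure, ENNReal.inv_mul_cancel h0 (ENNReal.natCast_ne_top n)]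

theorem measurePreserving_orbitMeasure {n : ℕ} {x : ShiftSpace d} (hx : x ∈ fixSet d n) :
    MeasurePreserving (shift d) (orbitMeasure n x) (orbitMeasure n x) := by
  refine ⟨measurable_shift, ?_⟩
  ext s hs
  rw [Measure.map_apply measurable_shift hs]
  simp only [orbitMeasure, Measure.smul_apply, Measure.finsetSum_apply,
    Measure.dirac_apply' _ hs, Measure.dirac_apply' _ (measurable_shift hs)]
  congr 1
  -- Splitting the sum over n + 1 iterates at either end shows that the shift trades the term at x
  -- for the term at σⁿ x = x.
  have h1 := Finset.sum_range_succ
    (fun i => s.indicator (1 : ShiftSpace d → ENNReal) ((shift d)^[i] x)) n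
  rw [Finset.sum_range_succ', show (shift d)^[n] x = x from hx] at h1
  have hfin : s.indicator (1 : ShiftSpace d → ENNReal) x ≠ ⊤ := by
    by_cases h : x ∈ s <;> simp [h]
  rw [Function.iterate_zero_apply] at h1
  rw [← (ENNReal.add_left_inj hfin).1 h1]
  refine Finset.sum_congr rfl fun i _ => ?_
  rw [Function.iterate_succ_apply']
  rfl

theorem integral_orbitMeasure (n : ℕ) (g : ShiftSpace d → ℝ) (x : ShiftSpace d) :
    ∫ y, g y ∂(orbitMeasure n x) = birkhoffSum (shift d) g n x / n := by
  rw [orbitMeasure, integral_smul_measure,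
    integral_finsetSum_measure fun i _ => integrable_dirac (by simp)]
  simp [birkhoffSum, div_eq_inv_mul]

theorem integral_birkhoffSum {ν : Measure (ShiftSpace d)} [IsProbabilityMeasure ν]
    (hν : MeasurePreserving (shift d) ν ν) (hc : Continuous f) (n : ℕ) :
    ∫ x, birkhoffSum (shift d) f n x ∂ν = n * ∫ x, f x ∂ν := by
  have hint : Integrable f ν :=
    hc.integrable_of_hasCompactSupport (HasCompactSupport.of_compactSpace f)
  simp only [birkhoffSum]
  rw [integral_finsetSum (f := fun i x => f ((shift d)^[i] x)) _
    fun i _ => (hν.iterate i).integrable_comp_of_integrable hint]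
  have : ∀ i : ℕ, ∫ x, f ((shift d)^[i] x) ∂ν = ∫ x, f x ∂ν := fun i => by
    have h := hν.iterate i
    nth_rewrite 2 [← h.map_eq]
    rw [integral_map h.measurable.aemeasurable hc.aestronglyMeasurable]
  simp [this]

/-! ### Periodic orbits and the maximal ergodic average -/

section Beta

variable (h0 : 0 < θ) (h1 : θ < 1) (hC : 0 ≤ C) (hf : HasVariation f C θ)
include h0 h1 hC hf

/-- Closing the first n symbols of any point to a periodic point changes the Birkhoff sum by an
amount independent of n. -/
theorem birkhoffSum_le_of_fixSet {a : ℝ}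
    (ha : ∀ n ≥ 1, ∀ y ∈ fixSet d n, birkhoffSum (shift d) f n y ≤ n * a)
    {n : ℕ} (hn : 1 ≤ n) (x : ShiftSpace d) :
    birkhoffSum (shift d) f n x ≤ n * a + C / (1 - θ) := by
  have h := hf.abs_birkhoffSum_sub_le h0 h1 hC n 0
    (agree_periodicExtension (q := n) (L := 0) (x := x) (by simp))
  have h' := ha n hn _ (periodicExtension_mem_fixSet n x)
  rw [pow_zero, mul_one] at h
  linarith [(abs_le.1 h).2]

/-- Integrating the bound on fⁿ against ν gives n ∫ f dν ≤ n a + const; large n removes the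
constant. -/
theorem integral_le_of_fixSet {a : ℝ}
    (ha : ∀ n ≥ 1, ∀ y ∈ fixSet d n, birkhoffSum (shift d) f n y ≤ n * a)
    {ν : Measure (ShiftSpace d)} [IsProbabilityMeasure ν]
    (hν : MeasurePreserving (shift d) ν ν) : ∫ x, f x ∂ν ≤ a := by
  have hc := hf.continuous h0 h1
  have key : ∀ n : ℕ, 1 ≤ n → n * (∫ x, f x ∂ν) ≤ n * a + C / (1 - θ) := by
    intro n hn
    rw [← integral_birkhoffSum hν hc n]
    have hcont : Continuous (birkhoffSum (shift d) f n) := by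
      have hs : Continuous (shift d) := continuous_pi fun i => continuous_apply (i + 1)
      unfold birkhoffSum
      exact continuous_finsetSum _ fun i _ => hc.comp (hs.iterate i)
    have := integral_mono (μ := ν) (hcont.integrable_of_hasCompactSupport
      (HasCompactSupport.of_compactSpace _)) (integrable_const (n * a + C / (1 - θ)))
      fun x => birkhoffSum_le_of_fixSet h0 h1 hC hf ha hn x
    simpa using this
  by_contra! hlt
  obtain ⟨n, hn⟩ := exists_nat_gt (C / (1 - θ) / ((∫ x, f x ∂ν) - a))
  have hpos : 0 < (∫ x, f x ∂ν) - a := by linarith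
  rw [div_lt_iff₀ hpos] at hn
  have := key (n + 1) (by omega)
  push_cast at this
  nlinarith

theorem bddAbove_integrals : BddAbove {r : ℝ | ∃ ν : Measure (ShiftSpace d),
    IsProbabilityMeasure ν ∧ MeasurePreserving (shift d) ν ν ∧ r = ∫ x, f x ∂ν} := by
  obtain ⟨M, hM⟩ := isCompact_univ.bddAbove_image (hf.continuous h0 h1).continuousOn
  refine ⟨M, ?_⟩
  rintro r ⟨ν, hν, hinv, rfl⟩
  refine integral_le_of_fixSet h0 h1 hC hf (fun n _ y _ => ?_) hinv
  simpa [birkhoffSum] using Finset.sum_le_card_nsmul (Finset.range n) (fun i => f ((shift d)^[i] y)) M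
    fun i _ => hM ⟨_, trivial, rfl⟩

theorem birkhoffSum_le_mul_beta {n : ℕ} {y : ShiftSpace d} (hy : y ∈ fixSet d n) :
    birkhoffSum (shift d) f n y ≤ n * beta f := by
  rcases Nat.eq_zero_or_pos n with rfl | hn
  · simp
  · have := le_csSup (bddAbove_integrals h0 h1 hC hf) ⟨orbitMeasure n y,
      isProbabilityMeasure_orbitMeasure hn y, measurePreserving_orbitMeasure hy,
      (integral_orbitMeasure n f y).symm⟩
    rwa [div_le_iff₀ (by positivity), mul_comm] at this

theorem exists_birkhoffSum_gt_mul (hd : 1 ≤ d) {a : ℝ} (ha : a < beta f) :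
    ∃ n ≥ 1, ∃ y ∈ fixSet d n, n * a < birkhoffSum (shift d) f n y := by
  by_contra! h
  refine ha.not_ge (csSup_le ?_ ?_)
  · let y : ShiftSpace d := fun _ => ⟨0, hd⟩
    have hy : y ∈ fixSet d 1 := mem_fixSet_iff.2 fun _ => rfl
    exact ⟨_, orbitMeasure 1 y, isProbabilityMeasure_orbitMeasure le_rfl y,
      measurePreserving_orbitMeasure hy, rfl⟩
  · rintro r ⟨ν, hν, hinv, rfl⟩
    exact integral_le_of_fixSet h0 h1 hC hf h hinv

/-- A long periodic orbit returns close to itself within bounded time, and can then be cut into two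
periodic orbits at a small cost. -/
theorem exists_cut {ε : ℝ} (hε : 0 < ε) : ∃ M ≥ 1, ∀ n > M, ∀ y ∈ fixSet d n,
    ∃ p ≥ 1, p ≤ M ∧ ∃ z₁ ∈ fixSet d p, ∃ z₂ ∈ fixSet d (n - p),
      birkhoffSum (shift d) f n y ≤
        birkhoffSum (shift d) f p z₁ + birkhoffSum (shift d) f (n - p) z₂ + ε := by
  have ht : Tendsto (fun n : ℕ => C / (1 - θ) * θ ^ n) atTop (𝓝 0) := by
    simpa using (tendsto_pow_atTop_nhds_zero_of_lt_one h0.le h1).const_mul (C / (1 - θ))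
  obtain ⟨L, hL⟩ := (ht.eventually (gt_mem_nhds (half_pos hε))).exists
  -- Pigeonhole: among d^L + 1 starting times, two see the same word of length L. Here L makes each
  -- closing error less than ε/2.
  refine ⟨d ^ L + 1, by omega, fun n hn y hy => ?_⟩
  obtain ⟨i, j, hij, heq⟩ : ∃ i j : Fin (d ^ L + 1), i < j ∧
      (fun t : Fin L => y (t + i)) = fun t : Fin L => y (t + j) := by
    obtain ⟨i, j, hne, heq⟩ := Fintype.exists_ne_map_eq_of_card_lt
      (fun (i : Fin (d ^ L + 1)) (t : Fin L) => y (t + i)) (by simp)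
    rcases hne.lt_or_gt with h | h
    · exact ⟨i, j, h, heq⟩
    · exact ⟨j, i, h, heq.symm⟩
  have hij' : (i : ℕ) < j := hij
  have hj := j.2
  obtain ⟨p, hp⟩ : ∃ p, p = (j : ℕ) - i := ⟨_, rfl⟩
  set x := (shift d)^[i] y with hx
  have hxfix : x ∈ fixSet d n := shift_iterate_mem_fixSet hy i
  have hret : ∀ t < L, x (t + p) = x t := by
    intro t htL
    have := congrFun heq ⟨t, htL⟩
    simp only [hx, shift_iterate_apply]
    rw [show t + p + (i : ℕ) = t + j by omega]
    exact this.symm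
  -- The complementary segment also nearly closes up, since x has period n.
  have hret' : ∀ t < L, (shift d)^[p] x (t + (n - p)) = (shift d)^[p] x t := by
    intro t htL
    rw [shift_iterate_apply, shift_iterate_apply, show t + (n - p) + p = t + n by omega,
      mem_fixSet_iff.1 hxfix, hret t htL]
  refine ⟨p, by omega, by omega, _, periodicExtension_mem_fixSet p x, _,
    periodicExtension_mem_fixSet (n - p) ((shift d)^[p] x), ?_⟩
  have e1 := (abs_le.1 (hf.abs_birkhoffSum_sub_le h0 h1 hC p L (agree_periodicExtension hret))).2
  have e2 := (abs_le.1 (hf.abs_birkhoffSum_sub_le h0 h1 hC (n - p) L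
    (agree_periodicExtension hret'))).2
  have e3 : birkhoffSum (shift d) f n y = birkhoffSum (shift d) f p x +
      birkhoffSum (shift d) f (n - p) ((shift d)^[p] x) := by
    rw [← birkhoffSum_add, show p + (n - p) = n by omega, hx, birkhoffSum_shift_iterate hy]
  linarith

/-- Suppose every deficit is at least δ. Each cut removes a piece of period at most M with deficit
at least δ, at cost δ/2, so a net loss of δ/2 is spread over at most M symbols. Induction on the
period pushes all periodic averages down to β(f) - δ/(2M), contradicting
`exists_birkhoffSum_gt_mul`. -/
theorem exists_birkhoffSum_gt_sub (hd : 1 ≤ d) {δ : ℝ} (hδ : 0 < δ) :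
    ∃ n ≥ 1, ∃ y ∈ fixSet d n, n * beta f - δ < birkhoffSum (shift d) f n y := by
  by_contra! h
  obtain ⟨M, hM, hcut⟩ := exists_cut h0 h1 hC hf (half_pos hδ)
  have hM0 : (0 : ℝ) < M := by exact_mod_cast hM
  have key : ∀ n ≥ 1, ∀ y ∈ fixSet d n,
      birkhoffSum (shift d) f n y ≤ n * (beta f - δ / 2 / M) := by
    intro n
    induction n using Nat.strong_induction_on with
    | _ n ih =>
      intro hn y hy
      have hbd : ∀ q : ℕ, q ≤ M → q * (δ / 2 / M) ≤ δ / 2 := fun q hq => by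
        have : (q : ℝ) ≤ M := by exact_mod_cast hq
        rw [mul_div_left_comm]
        exact mul_le_of_le_one_right (by positivity) ((div_le_one hM0).2 this)
      by_cases hnM : n ≤ M
      · linarith [h n hn y hy, hbd n hnM]
      · obtain ⟨p, hp1, hpM, z₁, hz₁, z₂, hz₂, hle⟩ := hcut n (by omega) y hy
        have i1 := h p hp1 z₁ hz₁
        have i2 := ih (n - p) (by omega) (by omega) z₂ hz₂
        rw [Nat.cast_sub (by omega)] at i2
        linarith [hbd p hpM]
  obtain ⟨n, hn, y, hy, hlt⟩ := exists_birkhoffSum_gt_mul h0 h1 hC hf hd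
    (a := beta f - δ / 2 / M) (sub_lt_self _ (by positivity))
  exact hlt.not_ge (key n hn y hy)

end Beta
-- The rate of a periodic point
theorem rate_eq {y : ShiftSpace d} (hy : y ∈ Per d) :
    rate f y = Function.minimalPeriod (shift d) y * beta f -
      birkhoffSum (shift d) f (Function.minimalPeriod (shift d) y) y := by
  have h : (Function.minimalPeriod (shift d) y : ℝ) ≠ 0 := by
    exact_mod_cast (Function.minimalPeriod_pos_of_mem_periodicPts hy).ne'
  rw [rate, mul_sub, mul_div_cancel₀ _ h]

theorem minimalPeriod_mem_fixSet (y : ShiftSpace d) :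
    y ∈ fixSet d (Function.minimalPeriod (shift d) y) :=
  Function.iterate_minimalPeriod

theorem mem_per_of_mem_fixSet {n : ℕ} (hn : 1 ≤ n) {y : ShiftSpace d} (hy : y ∈ fixSet d n) :
    y ∈ Per d :=
  Function.mk_mem_periodicPts hn hy

/-- A point of Fix_n runs through its minimal orbit j times, and its deficit is additive over these
turns. -/
theorem mul_rate_eq {n : ℕ} (hn : 1 ≤ n) {y : ShiftSpace d} (hy : y ∈ fixSet d n) :
    ∃ j ≥ 1, n * beta f - birkhoffSum (shift d) f n y = (j : ℕ) * rate f y := by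
  have hper : Function.IsPeriodicPt (shift d) n y := hy
  obtain ⟨j, hj⟩ := hper.minimalPeriod_dvd
  refine ⟨j, Nat.pos_of_ne_zero ?_, ?_⟩
  · rintro rfl
    omega
  · rw [rate_eq (mem_per_of_mem_fixSet hn hy)]
    nth_rewrite 1 2 [hj]
    rw [birkhoffSum_mul_of_mem_fixSet (minimalPeriod_mem_fixSet y)]
    push_cast
    ring

theorem ncard_fixSet_le {n : ℕ} (hn : 1 ≤ n) : (fixSet d n).ncard ≤ d ^ n := by
  have hinj : Set.InjOn (fun (x : ShiftSpace d) (i : Fin n) => x i) (fixSet d n) := by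
    intro x hx y hy hxy
    have hx' : periodicExtension n x = x :=
      funext fun t => (agree_periodicExtension (L := t + 1)
        (fun s _ => mem_fixSet_iff.1 hx s) t (by omega)).symm
    have hy' : periodicExtension n y = y :=
      funext fun t => (agree_periodicExtension (L := t + 1)
        (fun s _ => mem_fixSet_iff.1 hy s) t (by omega)).symm
    rw [← hx', ← hy']
    exact funext fun t => congrFun hxy ⟨t % n, Nat.mod_lt _ hn⟩
  calc (fixSet d n).ncard ≤ (Set.univ : Set (Fin n → Fin d)).ncard :=
        Set.ncard_le_ncard_of_injOn _ (fun _ _ => trivial) hinj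
    _ = d ^ n := by simp [Set.ncard_univ]

/-! ### Masses as quotients of visit sums -/

/-- The numerator of `π_{c,N}(s)`. -/
noncomputable def visitSum (f : ShiftSpace d → ℝ) (s : Set (ShiftSpace d)) (c : ℝ) (N : ℕ) : ℝ :=
  ∑ n ∈ Finset.Icc 1 N, ∑ᶠ x ∈ fixSet d n,
    weight f c n x * (birkhoffSum (shift d) (s.indicator 1) n x / n)

theorem partitionSum_eq_visitSum (c : ℝ) (N : ℕ) :
    partitionSum f c N = visitSum f Set.univ c N := by
  refine Finset.sum_congr rfl fun n hn => finsum_congr fun x => finsum_congr fun _ => ?_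
  have h : (n : ℝ) ≠ 0 := by
    have := (Finset.mem_Icc.1 hn).1
    positivity
  simp [birkhoffSum, h]

theorem measurableSet_cylinder {m : ℕ} (w : Fin m → Fin d) : MeasurableSet (cylinder w) := by
  have : cylinder w = ⋂ i : Fin m, (fun x : ShiftSpace d => x i) ⁻¹' {w i} := by
    ext x
    simp [cylinder]
  rw [this]
  exact MeasurableSet.iInter fun i => measurable_pi_apply _ (measurableSet_singleton _)

theorem piMeasure_real_eq {s : Set (ShiftSpace d)} (hs : MeasurableSet s) (c : ℝ) (N : ℕ) :
    (piMeasure f c N).real s = visitSum f s c N / visitSum f Set.univ c N := by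
  rw [← integral_indicator_one hs, integral_piMeasure, ← partitionSum_eq_visitSum]
  rfl

theorem birkhoffSum_indicator_div_nonneg (s : Set (ShiftSpace d)) (n : ℕ) (x : ShiftSpace d) :
    0 ≤ birkhoffSum (shift d) (s.indicator (1 : ShiftSpace d → ℝ)) n x / n := by
  refine div_nonneg (Finset.sum_nonneg fun i _ => ?_) n.cast_nonneg
  exact Set.indicator_nonneg (fun _ _ => zero_le_one) _

theorem birkhoffSum_indicator_div_le_one (s : Set (ShiftSpace d)) (n : ℕ) (x : ShiftSpace d) :
    birkhoffSum (shift d) (s.indicator (1 : ShiftSpace d → ℝ)) n x / n ≤ 1 := by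
  refine div_le_one_of_le₀ ?_ n.cast_nonneg
  have := Finset.sum_le_card_nsmul (Finset.range n)
    (fun i => s.indicator (1 : ShiftSpace d → ℝ) ((shift d)^[i] x)) 1
    fun i _ => Set.indicator_le_self' (fun _ _ => zero_le_one) _
  simpa [birkhoffSum] using this

theorem exists_mem_of_birkhoffSum_indicator_ne_zero {s : Set (ShiftSpace d)} {n : ℕ}
    {x : ShiftSpace d} (h : birkhoffSum (shift d) (s.indicator (1 : ShiftSpace d → ℝ)) n x ≠ 0) :
    ∃ i, (shift d)^[i] x ∈ s := by
  by_contra! hs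
  exact h (Finset.sum_eq_zero fun i _ => Set.indicator_of_notMem (hs i) _)

section Rate

variable (h0 : 0 < θ) (h1 : θ < 1) (hC : 0 ≤ C) (hf : HasVariation f C θ)
include h0 h1 hC hf

theorem rate_nonneg {y : ShiftSpace d} (hy : y ∈ Per d) : 0 ≤ rate f y := by
  rw [rate_eq hy, sub_nonneg]
  exact birkhoffSum_le_mul_beta h0 h1 hC hf (minimalPeriod_mem_fixSet y)

theorem rate_le {n : ℕ} (hn : 1 ≤ n) {y : ShiftSpace d} (hy : y ∈ fixSet d n) :
    rate f y ≤ n * beta f - birkhoffSum (shift d) f n y := by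
  obtain ⟨j, hj, hj'⟩ := mul_rate_eq (f := f) hn hy
  rw [hj']
  exact le_mul_of_one_le_left (rate_nonneg h0 h1 hC hf (mem_per_of_mem_fixSet hn hy))
    (by exact_mod_cast hj)

/-- This keeps the normalising constant from decaying exponentially in c. -/
theorem exists_rate_lt (hd : 1 ≤ d) {δ : ℝ} (hδ : 0 < δ) : ∃ y ∈ Per d, rate f y < δ := by
  obtain ⟨n, hn, y, hy, h⟩ := exists_birkhoffSum_gt_sub h0 h1 hC hf hd hδ
  exact ⟨y, mem_per_of_mem_fixSet hn hy, by linarith [rate_le h0 h1 hC hf hn hy]⟩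

/-! ### Bounds for the pressure -/

omit h0 h1 hC hf in
theorem mul_birkhoffSum (c : ℝ) (n : ℕ) (x : ShiftSpace d) :
    birkhoffSum (shift d) (fun y => c * f y) n x = c * birkhoffSum (shift d) f n x := by
  simp [birkhoffSum, Finset.mul_sum]

omit h0 h1 hC hf in
theorem exists_mem_cylinder (hd : 1 ≤ d) {m : ℕ} (w : Fin m → Fin d) : (cylinder w).Nonempty :=
  ⟨fun t => if h : t < m then w ⟨t, h⟩ else ⟨0, hd⟩, fun i => by simp⟩

theorem exp_mul_birkhoffSum_le {c : ℝ} (hc : 0 ≤ c) {n : ℕ} (hn : 1 ≤ n) (x : ShiftSpace d) :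
    Real.exp (birkhoffSum (shift d) (fun y => c * f y) n x) ≤
      Real.exp (c * (n * beta f + C / (1 - θ))) := by
  rw [mul_birkhoffSum]
  exact Real.exp_le_exp.2 (mul_le_mul_of_nonneg_left (birkhoffSum_le_of_fixSet h0 h1 hC hf
    (fun n _ y hy => birkhoffSum_le_mul_beta h0 h1 hC hf hy) hn x) hc)

theorem exp_le_sum_sSup {c : ℝ} (hc : 0 ≤ c) {n : ℕ} (hn : 1 ≤ n) (x : ShiftSpace d) :
    Real.exp (birkhoffSum (shift d) (fun y => c * f y) n x) ≤ ∑ w : Fin n → Fin d,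
      sSup ((fun x => Real.exp (birkhoffSum (shift d) (fun y => c * f y) n x)) '' cylinder w) := by
  have hbdd : BddAbove ((fun x => Real.exp (birkhoffSum (shift d) (fun y => c * f y) n x)) ''
      cylinder fun i : Fin n => x i) := by
    refine ⟨Real.exp (c * (n * beta f + C / (1 - θ))), ?_⟩
    rintro _ ⟨z, _, rfl⟩
    exact exp_mul_birkhoffSum_le h0 h1 hC hf hc hn z
  refine (le_csSup hbdd ⟨x, fun _ => rfl, rfl⟩).trans
    (Finset.single_le_sum (f := fun w : Fin n → Fin d => sSup ((fun x =>
      Real.exp (birkhoffSum (shift d) (fun y => c * f y) n x)) '' cylinder w))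
      (fun w _ => Real.sSup_nonneg ?_) (Finset.mem_univ fun i : Fin n => x i))
  rintro _ ⟨z, _, rfl⟩
  exact (Real.exp_pos _).le

theorem log_sum_sSup_div_le (hd : 1 ≤ d) {c : ℝ} (hc : 0 ≤ c) {n : ℕ} (hn : 1 ≤ n) :
    Real.log (∑ w : Fin n → Fin d,
      sSup ((fun x => Real.exp (birkhoffSum (shift d) (fun y => c * f y) n x)) '' cylinder w)) / n ≤
      Real.log d + c * beta f + c * (C / (1 - θ)) / n := by
  have hn0 : (0 : ℝ) < n := by exact_mod_cast hn
  have hd0 : (0 : ℝ) < d := by exact_mod_cast hd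
  have hsum : (∑ w : Fin n → Fin d, sSup ((fun x =>
      Real.exp (birkhoffSum (shift d) (fun y => c * f y) n x)) '' cylinder w)) ≤
      d ^ n * Real.exp (c * (n * beta f + C / (1 - θ))) := by
    refine (Finset.sum_le_card_nsmul _ _ (Real.exp (c * (n * beta f + C / (1 - θ))))
      fun w _ => csSup_le ((exists_mem_cylinder hd w).image _) ?_).trans (by simp)
    rintro _ ⟨z, _, rfl⟩
    exact exp_mul_birkhoffSum_le h0 h1 hC hf hc hn z
  have hlog := Real.log_le_log ((Real.exp_pos _).trans_le
    (exp_le_sum_sSup h0 h1 hC hf hc hn (fun _ => ⟨0, hd⟩ : ShiftSpace d))) hsum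
  rw [Real.log_mul (by positivity) (Real.exp_ne_zero _), Real.log_exp, Real.log_pow] at hlog
  rw [div_le_iff₀ hn0]
  refine hlog.trans (le_of_eq ?_)
  field_simp
  ring

/-- Repeating one good periodic orbit gives the bound at the multiples of its period, which suffices
for a limsup. -/
theorem frequently_le_log_sum_sSup_div (hd : 1 ≤ d) {c : ℝ} (hc : 0 ≤ c) {a : ℝ}
    (ha : a < beta f) :
    ∃ᶠ n : ℕ in atTop, c * a ≤ Real.log (∑ w : Fin n → Fin d, sSup ((fun x =>
      Real.exp (birkhoffSum (shift d) (fun y => c * f y) n x)) '' cylinder w)) / n := by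
  obtain ⟨q, hq, y, hy, hlt⟩ := exists_birkhoffSum_gt_mul h0 h1 hC hf hd ha
  rw [frequently_atTop]
  intro k
  have hn : 1 ≤ q * (k + 1) := Nat.mul_pos hq k.succ_pos
  refine ⟨q * (k + 1), by nlinarith, ?_⟩
  have hn0 : (0 : ℝ) < (q * (k + 1) : ℕ) := by exact_mod_cast hn
  rw [le_div_iff₀ hn0]
  have hlog := Real.log_le_log (Real.exp_pos _) (exp_le_sum_sSup h0 h1 hC hf hc hn y)
  rw [Real.log_exp, mul_birkhoffSum, birkhoffSum_mul_of_mem_fixSet hy] at hlog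
  refine le_trans ?_ hlog
  rw [mul_assoc]
  refine mul_le_mul_of_nonneg_left ?_ hc
  have := mul_le_mul_of_nonneg_left hlt.le (Nat.cast_nonneg (α := ℝ) (k + 1))
  push_cast at this ⊢
  linarith

theorem pressure_le (hd : 1 ≤ d) {c : ℝ} (hc : 0 ≤ c) :
    pressure (fun y => c * f y) ≤ Real.log d + c * beta f := by
  have ht : Tendsto (fun n : ℕ => Real.log d + c * beta f + c * (C / (1 - θ)) / n) atTop
      (𝓝 (Real.log d + c * beta f)) := by
    simpa using (tendsto_const_div_atTop_nhds_zero_nat (c * (C / (1 - θ)))).const_add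
      (Real.log d + c * beta f)
  rw [← ht.limsup_eq]
  refine limsup_le_limsup ?_ ?_ ht.isBoundedUnder_le
  · filter_upwards [eventually_ge_atTop 1] with n hn
    exact log_sum_sSup_div_le h0 h1 hC hf hd hc hn
  · exact IsCoboundedUnder.of_frequently_ge
      (frequently_le_log_sum_sSup_div h0 h1 hC hf hd hc (sub_one_lt (beta f)))

theorem le_pressure (hd : 1 ≤ d) {c : ℝ} (hc : 0 ≤ c) :
    c * beta f ≤ pressure (fun y => c * f y) := by
  have hbdd : IsBoundedUnder (· ≤ ·) atTop (fun n : ℕ =>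
      Real.log (∑ w : Fin n → Fin d, sSup ((fun x =>
        Real.exp (birkhoffSum (shift d) (fun y => c * f y) n x)) '' cylinder w)) / n) :=
    (tendsto_const_div_atTop_nhds_zero_nat (c * (C / (1 - θ)))).const_add
      (Real.log d + c * beta f) |>.isBoundedUnder_le.mono_le (by
        filter_upwards [eventually_ge_atTop 1] with n hn
        exact log_sum_sSup_div_le h0 h1 hC hf hd hc hn)
  have hle : ∀ a < beta f, c * a ≤ pressure (fun y => c * f y) := fun a ha =>
    le_limsup_of_frequently_le (frequently_le_log_sum_sSup_div h0 h1 hC hf hd hc ha) hbdd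
  have ht : Tendsto (fun a => c * a) (𝓝[<] beta f) (𝓝 (c * beta f)) :=
    ((continuous_const_mul c).tendsto _).mono_left nhdsWithin_le_nhds
  exact le_of_tendsto ht (eventually_mem_nhdsWithin.mono hle)

/-! ### Exponential bounds for visit sums -/

theorem visitSum_le (hd : 1 ≤ d) {s : Set (ShiftSpace d)} {J : ℝ}
    (hJ : ∀ y ∈ s ∩ Per d, J ≤ rate f y) {c : ℝ} (hc : 0 ≤ c) (N : ℕ) :
    visitSum f s c N ≤ N * d ^ N * Real.exp (-(c * J)) := by
  have hd1 : (1 : ℝ) ≤ d := by exact_mod_cast hd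
  have key : ∀ n ∈ Finset.Icc 1 N, ∑ᶠ x ∈ fixSet d n,
      weight f c n x * (birkhoffSum (shift d) (s.indicator 1) n x / n) ≤
      d ^ N * Real.exp (-(c * J)) := by
    intro n hn
    obtain ⟨hn1, hnN⟩ := Finset.mem_Icc.1 hn
    have hfin := fixSet_finite d n hn1
    rw [finsum_mem_eq_finite_toFinset_sum _ hfin]
    refine (Finset.sum_le_card_nsmul _ _ (Real.exp (-(c * J))) fun x hx => ?_).trans ?_
    · rw [hfin.mem_toFinset] at hx
      by_cases hz : birkhoffSum (shift d) (s.indicator (1 : ShiftSpace d → ℝ)) n x = 0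
      · rw [hz, zero_div, mul_zero]
        exact (Real.exp_pos _).le
      -- The hypothesis on J concerns points of s, so x is replaced by an iterate lying in s; this
      -- leaves the Birkhoff sum over n steps unchanged.
      · obtain ⟨i, hi⟩ := exists_mem_of_birkhoffSum_indicator_ne_zero hz
        have hfix := shift_iterate_mem_fixSet hx i
        have hr := rate_le h0 h1 hC hf hn1 hfix
        rw [birkhoffSum_shift_iterate hx] at hr
        have hJi := hJ _ ⟨hi, mem_per_of_mem_fixSet hn1 hfix⟩
        refine (mul_le_of_le_one_right (Real.exp_pos _).le
          (birkhoffSum_indicator_div_le_one s n x)).trans (Real.exp_le_exp.2 ?_)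
        have hP := mul_le_mul_of_nonneg_left (le_pressure h0 h1 hC hf hd hc)
          (Nat.cast_nonneg (α := ℝ) n)
        have := mul_le_mul_of_nonneg_left (hJi.trans hr) hc
        linarith
    · rw [nsmul_eq_mul]
      refine mul_le_mul_of_nonneg_right ?_ (Real.exp_pos _).le
      rw [← Set.ncard_eq_toFinset_card _ hfin]
      calc ((fixSet d n).ncard : ℝ) ≤ (d : ℝ) ^ n := by exact_mod_cast ncard_fixSet_le hn1
        _ ≤ d ^ N := pow_le_pow_right₀ hd1 hnN
  refine (Finset.sum_le_card_nsmul _ _ _ key).trans (le_of_eq ?_)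
  simp [mul_assoc]

theorem le_visitSum (hd : 1 ≤ d) {s : Set (ShiftSpace d)} {y : ShiftSpace d}
    (hs : y ∈ s) (hy : y ∈ Per d) {c : ℝ} (hc : 0 ≤ c) {N : ℕ}
    (hN : Function.minimalPeriod (shift d) y ≤ N) :
    Real.exp (-(c * rate f y) - Function.minimalPeriod (shift d) y * (Real.log d + 1)) ≤
      visitSum f s c N := by
  have hpos := Function.minimalPeriod_pos_of_mem_periodicPts hy
  have hr := rate_eq (f := f) hy
  have hfix := minimalPeriod_mem_fixSet y
  set n := Function.minimalPeriod (shift d) y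
  have hn0 : (0 : ℝ) < n := by exact_mod_cast hpos
  have hterm : ∀ n (x : ShiftSpace d), 0 ≤
      weight f c n x * (birkhoffSum (shift d) (s.indicator (1 : ShiftSpace d → ℝ)) n x / n) :=
    fun n x => mul_nonneg (Real.exp_pos _).le (birkhoffSum_indicator_div_nonneg s n x)
  have hfin := fixSet_finite d n hpos
  -- The orbit spends at least 1/n of its time in s. The weaker bound exp(-n) merges with the
  -- pressure error n log d.
  have hone : Real.exp (-(n : ℝ)) ≤
      birkhoffSum (shift d) (s.indicator (1 : ShiftSpace d → ℝ)) n y / n := by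
    have h2 : (1 : ℝ) ≤ birkhoffSum (shift d) (s.indicator (1 : ShiftSpace d → ℝ)) n y := by
      have := Finset.single_le_sum
        (f := fun i => s.indicator (1 : ShiftSpace d → ℝ) ((shift d)^[i] y))
        (fun i _ => Set.indicator_nonneg (fun _ _ => zero_le_one) _) (Finset.mem_range.2 hpos)
      simpa [hs, birkhoffSum] using this
    have h3 : (n : ℝ) ≤ Real.exp n := by linarith [Real.add_one_le_exp (n : ℝ)]
    rw [Real.exp_neg]
    exact ((inv_anti₀ hn0 h3).trans_eq (one_div _).symm).trans
      (div_le_div_of_nonneg_right h2 hn0.le)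
  have hw : Real.exp (-(c * rate f y) - n * Real.log d) ≤ weight f c n y := by
    refine Real.exp_le_exp.2 ?_
    have := mul_le_mul_of_nonneg_left (pressure_le h0 h1 hC hf hd hc) hn0.le
    rw [hr]
    linarith
  calc Real.exp (-(c * rate f y) - n * (Real.log d + 1))
      = Real.exp (-(c * rate f y) - n * Real.log d) * Real.exp (-(n : ℝ)) := by
        rw [← Real.exp_add]
        ring_nf
    _ ≤ weight f c n y *
        (birkhoffSum (shift d) (s.indicator (1 : ShiftSpace d → ℝ)) n y / n) :=
        mul_le_mul hw hone (Real.exp_pos _).le (Real.exp_pos _).le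
    _ ≤ ∑ᶠ x ∈ fixSet d n,
        weight f c n x * (birkhoffSum (shift d) (s.indicator 1) n x / n) := by
        rw [finsum_mem_eq_finite_toFinset_sum _ hfin]
        exact Finset.single_le_sum (f := fun x => weight f c n x *
          (birkhoffSum (shift d) (s.indicator (1 : ShiftSpace d → ℝ)) n x / n))
          (fun x _ => hterm n x) (hfin.mem_toFinset.2 hfix)
    _ ≤ visitSum f s c N :=
        Finset.single_le_sum (f := fun n => ∑ᶠ x ∈ fixSet d n, weight f c n x *
          (birkhoffSum (shift d) (s.indicator (1 : ShiftSpace d → ℝ)) n x / n))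
          (fun k _ => finsum_mem_induction (fun r : ℝ => 0 ≤ r) le_rfl
            (fun _ _ => add_nonneg) (fun x _ => hterm k x)) (Finset.mem_Icc.2 ⟨hpos, hN⟩)

theorem visitSum_pos (hd : 1 ≤ d) {s : Set (ShiftSpace d)} {y : ShiftSpace d}
    (hs : y ∈ s) (hy : y ∈ Per d) {c : ℝ} (hc : 0 ≤ c) {N : ℕ}
    (hN : Function.minimalPeriod (shift d) y ≤ N) : 0 < visitSum f s c N :=
  (Real.exp_pos _).trans_le (le_visitSum h0 h1 hC hf hd hs hy hc hN)

theorem le_log_visitSum (hd : 1 ≤ d) {s : Set (ShiftSpace d)} {y : ShiftSpace d}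
    (hs : y ∈ s) (hy : y ∈ Per d) {c : ℝ} (hc : 0 ≤ c) {N : ℕ}
    (hN : Function.minimalPeriod (shift d) y ≤ N) :
    -(c * rate f y) - Function.minimalPeriod (shift d) y * (Real.log d + 1) ≤
      Real.log (visitSum f s c N) := by
  rw [Real.le_log_iff_exp_le (visitSum_pos h0 h1 hC hf hd hs hy hc hN)]
  exact le_visitSum h0 h1 hC hf hd hs hy hc hN

theorem log_visitSum_le (hd : 1 ≤ d) {s : Set (ShiftSpace d)} {J : ℝ}
    (hJ : ∀ y ∈ s ∩ Per d, J ≤ rate f y) {c : ℝ} (hc : 0 ≤ c) {N : ℕ}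
    (hpos : 0 < visitSum f s c N) (hN : 1 ≤ N) :
    Real.log (visitSum f s c N) ≤ N * (Real.log d + 1) - c * J := by
  have hd0 : (0 : ℝ) < d := by exact_mod_cast hd
  have hN0 : (0 : ℝ) < N := by exact_mod_cast hN
  have h := Real.log_le_log hpos (visitSum_le h0 h1 hC hf hd hJ hc N)
  rw [Real.log_mul (by positivity) (Real.exp_ne_zero _), Real.log_exp,
    Real.log_mul (by positivity) (by positivity), Real.log_pow] at h
  linarith [Real.log_le_sub_one_of_pos hN0]

/-! ### The rate on a cylinder and its extension -/

theorem bddBelow_rate_image (s : Set (ShiftSpace d)) : BddBelow (rate f '' (s ∩ Per d)) := by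
  refine ⟨0, ?_⟩
  rintro _ ⟨y, hy, rfl⟩
  exact rate_nonneg h0 h1 hC hf hy.2

omit h0 h1 hC hf in
theorem cylinder_inter_per_nonempty (hd : 1 ≤ d) {m : ℕ} (w : Fin m → Fin d) :
    (cylinder w ∩ Per d).Nonempty := by
  obtain ⟨x, hx⟩ := exists_mem_cylinder hd w
  -- The period m + 1, rather than m, is positive even for the empty word.
  refine ⟨periodicExtension (m + 1) x, fun i => ?_,
    mem_per_of_mem_fixSet (by omega) (periodicExtension_mem_fixSet _ x)⟩
  rw [← hx i, periodicExtension, Nat.mod_eq_of_lt (by omega)]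

omit h0 h1 hC hf in
theorem rateExt_le_rate {y : ShiftSpace d} (hy : y ∈ Per d) :
    rateExt θ f y ≤ (rate f y : EReal) :=
  iSup₂_le fun ε hε => iInf₂_le y ⟨hy, by simpa [thetaDist] using le_of_lt hε⟩

/-- Periodic points within θ^(m+1) of a point of the cylinder lie in the cylinder, which gives ≤.
For ≥, the extension is at most the rate at each periodic point. -/
theorem coe_sInf_rate_eq (hd : 1 ≤ d) {m : ℕ} (w : Fin m → Fin d) :
    ((sInf (rate f '' (cylinder w ∩ Per d)) : ℝ) : EReal) = ⨅ x ∈ cylinder w, rateExt θ f x := by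
  apply le_antisymm
  · refine le_iInf₂ fun x hx => le_trans ?_
      (le_iSup₂ (f := fun ε (_ : ε ∈ Set.Ioi (0 : ℝ)) => localInf θ f x ε)
        (θ ^ (m + 1)) (pow_pos h0 _))
    refine le_iInf₂ fun y hy => EReal.coe_le_coe_iff.2
      (csInf_le (bddBelow_rate_image h0 h1 hC hf _) ⟨y, ⟨fun i => ?_, hy.1⟩, rfl⟩)
    rw [agree_of_thetaDist_le h0 h1 hy.2 i i.2, hx i]
  · by_contra! hlt
    obtain ⟨r, hr1, hr2⟩ := EReal.lt_iff_exists_real_btwn.1 hlt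
    obtain ⟨_, ⟨y, hy, rfl⟩, hyr⟩ := exists_lt_of_csInf_lt
      ((cylinder_inter_per_nonempty hd w).image _) (EReal.coe_lt_coe_iff.1 hr1)
    exact lt_asymm hr2 (((iInf₂_le y hy.1).trans (rateExt_le_rate hy.2)).trans_lt
      (EReal.coe_lt_coe_iff.2 hyr))

/-! ### Positivity and the logarithmic limit -/

omit h0 h1 hC hf in
theorem eventually_atTop_prod (n : ℕ) : ∀ᶠ p : ℝ × ℕ in atTop, 0 < p.1 ∧ n ≤ p.2 := by
  filter_upwards [eventually_ge_atTop ((1, n) : ℝ × ℕ)] with p hp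
  exact ⟨zero_lt_one.trans_le hp.1, hp.2⟩

theorem eventually_piMeasure_pos (hd : 1 ≤ d) {m : ℕ} (w : Fin m → Fin d) :
    ∀ᶠ p : ℝ × ℕ in atTop, 0 < (piMeasure f p.1 p.2).real (cylinder w) := by
  obtain ⟨y, hyw, hy⟩ := cylinder_inter_per_nonempty hd w
  filter_upwards [eventually_atTop_prod (Function.minimalPeriod (shift d) y)] with p hp
  rw [piMeasure_real_eq (measurableSet_cylinder w)]
  exact div_pos (visitSum_pos h0 h1 hC hf hd hyw hy hp.1.le hp.2)
    (visitSum_pos h0 h1 hC hf hd (Set.mem_univ y) hy hp.1.le hp.2)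

omit h0 h1 hC hf in
theorem tendsto_error (a b : ℝ) :
    Tendsto (fun p : ℝ × ℕ => p.2 / p.1 * a + b / p.1)
      (atTop ⊓ comap (fun p : ℝ × ℕ => (p.2 : ℝ) / p.1) (𝓝 0)) (𝓝 0) := by
  have hfst : Tendsto (fun p : ℝ × ℕ => p.1) atTop atTop := by
    rw [← prod_atTop_atTop_eq]
    exact tendsto_fst
  have h1 : Tendsto (fun p : ℝ × ℕ => (p.2 : ℝ) / p.1)
      (atTop ⊓ comap (fun p : ℝ × ℕ => (p.2 : ℝ) / p.1) (𝓝 0)) (𝓝 0) :=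
    tendsto_comap.mono_left inf_le_right
  simpa using (h1.mul_const a).add ((hfst.const_div_atTop b).mono_left inf_le_left)

theorem tendsto_log_piMeasure (hd : 1 ≤ d) {m : ℕ} (w : Fin m → Fin d) :
    Tendsto (fun p : ℝ × ℕ => 1 / p.1 * Real.log ((piMeasure f p.1 p.2).real (cylinder w)))
      (atTop ⊓ comap (fun p : ℝ × ℕ => (p.2 : ℝ) / p.1) (𝓝 0))
      (𝓝 (-sInf (rate f '' (cylinder w ∩ Per d)))) := by
  set K := sInf (rate f '' (cylinder w ∩ Per d)) with hK
  have hKle : ∀ y ∈ cylinder w ∩ Per d, K ≤ rate f y := fun y hy =>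
    csInf_le (bddBelow_rate_image h0 h1 hC hf _) ⟨y, hy, rfl⟩
  have hnonneg : ∀ y ∈ Set.univ ∩ Per d, 0 ≤ rate f y := fun y hy =>
    rate_nonneg h0 h1 hC hf hy.2
  rw [Metric.tendsto_nhds]
  intro ε hε
  -- The orbit of y bounds the numerator from below and that of z the denominator. Each spends ε/2
  -- on the rate and leaves ε/2 for the entropy and period errors.
  obtain ⟨_, ⟨y, hy, rfl⟩, hyK⟩ := exists_lt_of_csInf_lt
    ((cylinder_inter_per_nonempty hd w).image _) (lt_add_of_pos_right K (half_pos hε))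
  obtain ⟨z, hz, hzε⟩ := exists_rate_lt h0 h1 hC hf hd (half_pos hε)
  have hevent : ∀ n : ℕ, ∀ᶠ p : ℝ × ℕ in
      atTop ⊓ comap (fun p : ℝ × ℕ => (p.2 : ℝ) / p.1) (𝓝 0), 0 < p.1 ∧ n ≤ p.2 :=
    fun n => (eventually_atTop_prod n).filter_mono inf_le_left
  have herr : ∀ n : ℕ, ∀ᶠ p : ℝ × ℕ in
      atTop ⊓ comap (fun p : ℝ × ℕ => (p.2 : ℝ) / p.1) (𝓝 0),
      p.2 / p.1 * (Real.log d + 1) + n * (Real.log d + 1) / p.1 < ε / 2 :=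
    fun n => (tendsto_error _ _).eventually (gt_mem_nhds (half_pos hε))
  filter_upwards [hevent (Function.minimalPeriod (shift d) y),
    hevent (Function.minimalPeriod (shift d) z), herr (Function.minimalPeriod (shift d) y),
    herr (Function.minimalPeriod (shift d) z)] with p hpy hpz hey hez
  obtain ⟨hc, hN⟩ := hpy
  have hN1 : 1 ≤ p.2 := (Function.minimalPeriod_pos_of_mem_periodicPts hy.2).trans_le hN
  have hpos := visitSum_pos h0 h1 hC hf hd hy.1 hy.2 hc.le hN
  have hpos' := visitSum_pos h0 h1 hC hf hd (Set.mem_univ y) hy.2 hc.le hN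
  -- The pair u1, u2 bounds the quotient from above and l1, l2 from below; in l1 the rate bound for
  -- the denominator is 0.
  have u1 := log_visitSum_le h0 h1 hC hf hd hKle hc.le hpos hN1
  have u2 := le_log_visitSum h0 h1 hC hf hd (Set.mem_univ z) hz hc.le hpz.2
  have l1 := log_visitSum_le h0 h1 hC hf hd hnonneg hc.le hpos' hN1
  have l2 := le_log_visitSum h0 h1 hC hf hd hy.1 hy.2 hc.le hN
  rw [piMeasure_real_eq (measurableSet_cylinder w), Real.log_div hpos.ne' hpos'.ne', Real.dist_eq,
    one_div_mul_eq_div, sub_neg_eq_add, abs_lt]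
  rw [div_mul_eq_mul_div, ← add_div, div_lt_iff₀ hc] at hey hez
  have hyc := mul_lt_mul_of_pos_left hyK hc
  have hzc := mul_lt_mul_of_pos_left hzε hc
  constructor
  · rw [← sub_lt_iff_lt_add, lt_div_iff₀ hc]
    linarith
  · rw [← lt_sub_iff_add_lt, div_lt_iff₀ hc]
    linarith

end Rate
end PeriodicLDP

theorem theorem24 (d : ℕ) (hd : 1 ≤ d) (θ : ℝ) (hθ0 : 0 < θ) (hθ1 : θ < 1)
    (f : PeriodicLDP.ShiftSpace d → ℝ) (hf : PeriodicLDP.IsThetaLipschitz θ f)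
    (m : ℕ) (w : Fin m → Fin d) :
    (∀ᶠ p : ℝ × ℕ in atTop, 0 < (PeriodicLDP.piMeasure f p.1 p.2).real (PeriodicLDP.cylinder w)) ∧
    Tendsto
      (fun p : ℝ × ℕ =>
        1 / p.1 * Real.log ((PeriodicLDP.piMeasure f p.1 p.2).real (PeriodicLDP.cylinder w)))
      (atTop ⊓ comap (fun p : ℝ × ℕ => (p.2 : ℝ) / p.1) (𝓝 0))
      (𝓝 (-sInf (PeriodicLDP.rate f '' (PeriodicLDP.cylinder w ∩ PeriodicLDP.Per d)))) ∧
    ((sInf (PeriodicLDP.rate f '' (PeriodicLDP.cylinder w ∩ PeriodicLDP.Per d)) : ℝ) : EReal) =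
      ⨅ x ∈ PeriodicLDP.cylinder w, PeriodicLDP.rateExt θ f x := by
  obtain ⟨C, hC, hvar⟩ := hf.hasVariation hθ0 hθ1
  exact ⟨PeriodicLDP.eventually_piMeasure_pos hθ0 hθ1 hC hvar hd w,
    PeriodicLDP.tendsto_log_piMeasure hθ0 hθ1 hC hvar hd w,
    PeriodicLDP.coe_sInf_rate_eq hθ0 hθ1 hC hvar hd w⟩
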